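/- Let $q$ be a prime power, let $1\le R\le k\le m$ be integers, and let $\mathcal C\subseteq \mathrm{Mat}(k\times m,\mathbb F_q)$ be a Delsarte code, i.e. an $\mathbb F_q$-linear subspace, with $\dim_{\mathbb F_q}(\mathcal C)=mR$. For a Delsarte code $\mathcal D\subseteq \mathrm{Mat}(k\times m,\mathbb F_q)$ put $\mathrm{maxrk}(\mathcal D)=\max\{\mathrm{rk}(M): M\in\mathcal D\}$. The code $\mathcal D$ is called a Delsarte optimal anticode if $\dim_{\mathbb F_q}(\mathcal D)=m\cdot \mathrm{maxrk}(\mathcal D)$. For $1\le r\le \dim_{\mathbb F_q}(\mathcal D)$ the $r$-th Delsarte generalized weight of $\mathcal D$ is $$a_r(\mathcal D)=\frac1m\min\{\dim_{\mathbb F_q}(\mathcal A): \mathcal A\subseteq \mathrm{Mat}(k\times m,\mathbb F_q)\text{ a Delsarte optimal anticode},\ \dim_{\mathbb F_q}(\mathcal A\cap\mathcal D)\ge r\}.$$ The following are equivalent: 1. $\mathcal C$ is a Delsarte optimal anticode; 2. $a_{mR}(\mathcal C)=R$; 3. $a_r(\mathcal C)=\lceil r/m\rceil$ for all $r\in\{1,\dots,mR\}$.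 In particular, the Delsarte generalized weights of a Delsarte optimal anticode $\mathcal C\subseteq \mathrm{Mat}(k\times m,\mathbb F_q)$ depend only on $k$, $m$ and $\mathrm{maxrk}(\mathcal C)$: if $\mathcal C$ (of dimension $mR$) and $\mathcal D\subseteq\mathrm{Mat}(k\times m,\mathbb F_{q'})$, for any prime power $q'$, are Delsarte optimal anticodes with $\mathrm{maxrk}(\mathcal D)=\mathrm{maxrk}(\mathcal C)$, then $a_r(\mathcal D)=a_r(\mathcal C)$ for all $r\in\{1,\dots,mR\}$. -/

import Mathlib

namespace DelsarteCode

/-- The maximum rank of a code, i.e. of a linear subspace of the `k × m` matrices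
(the set of ranks is nonempty and bounded above by `k`, so that the supremum is a maximum). -/
noncomputable def maxrk {F : Type*} [Field F] {k m : ℕ}
    (C : Submodule F (Matrix (Fin k) (Fin m) F)) : ℕ :=
  sSup {s : ℕ | ∃ M ∈ C, M.rank = s}

/-- A Delsarte optimal anticode (for `1 ≤ k ≤ m`): a code whose dimension attains the
bound `dim C ≤ m * maxrk C`. -/
def IsOptimalAnticode {F : Type*} [Field F] {k m : ℕ}
    (C : Submodule F (Matrix (Fin k) (Fin m) F)) : Prop :=
  Module.finrank F C = m * maxrk C

/-- The `r`-th Delsarte generalized weight of a code `C` (for `1 ≤ k ≤ m` and `1 ≤ r ≤ dim C`):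
`1 / m` times the minimum dimension of an optimal anticode that meets `C` in dimension at
least `r`. The full matrix space is such an anticode, so that the infimum is a minimum. -/
noncomputable def genWeight {F : Type*} [Field F] {k m : ℕ} (r : ℕ)
    (C : Submodule F (Matrix (Fin k) (Fin m) F)) : ℚ :=
  (1 / (m : ℚ)) *
    ((sInf {d : ℕ | ∃ A : Submodule F (Matrix (Fin k) (Fin m) F),
      IsOptimalAnticode A ∧ r ≤ Module.finrank F (A ⊓ C : Submodule F _) ∧
        Module.finrank F A = d} : ℕ) : ℚ)

end DelsarteCode

namespace DelsarteCode

open Finset Matrix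

/-! An optimal anticode meeting `C` in dimension at least `r` has dimension `m * s ≥ r`, so
everything rests on `exists_subcode`: an optimal anticode of rank `R` contains optimal anticodes of
every rank `s ≤ R`. Leading positions in distinct rows and columns force large rank, so by Hall's
theorem `R` lines cover all leading positions. There are at least `m * R` of these, so the lines
must be `R` rows or, if `k = m`, possibly `R` columns. Up to transposition, `C` is thus parametrized
by `R` free rows. The rank bound puts every other row in the span of the free ones, whence it is a
combination of them with constant coefficients (`exists_eq_sum_smul_of_mem_span`). Letting only `s`
free rows be nonzero gives the subcode. -/

/-! ### Leading positions and rank -/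

/-- `p` is the lexicographically first nonzero position of some matrix in `C`. -/
def IsLeading {F : Type*} [Field F] {k m : ℕ}
    (C : Submodule F (Matrix (Fin k) (Fin m) F)) (p : Fin k × Fin m) : Prop :=
  ∃ M ∈ C, M p.1 p.2 ≠ 0 ∧ ∀ q : Fin k × Fin m, toLex q < toLex p → M q.1 q.2 = 0

theorem eq_zero_of_forall_isLeading {F : Type*} [Field F] {k m : ℕ}
    {C : Submodule F (Matrix (Fin k) (Fin m) F)} {M : Matrix (Fin k) (Fin m) F} (hM : M ∈ C)
    (h : ∀ p, IsLeading C p → M p.1 p.2 = 0) : M = 0 := by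
  by_contra hne
  have hex : ∃ q : Fin k ×ₗ Fin m, M (ofLex q).1 (ofLex q).2 ≠ 0 := by
    by_contra! hall
    exact hne (Matrix.ext fun i j => hall (toLex (i, j)))
  obtain ⟨q, hq, hmin⟩ := WellFounded.has_min
    (wellFounded_lt (α := Fin k ×ₗ Fin m)) {q | M (ofLex q).1 (ofLex q).2 ≠ 0} hex
  refine hq (h (ofLex q) ⟨M, hM, hq, fun p hp => ?_⟩)
  by_contra hp0
  exact hmin (toLex p) hp0 hp

theorem det_eq_prod_diag_of_blockTriangular {F ι α : Type*} [CommRing F] [Fintype ι]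
    [DecidableEq ι] [LinearOrder α] {D : Matrix ι ι F} {b : ι → α} (hb : Function.Injective b)
    (hD : D.BlockTriangular b) : D.det = ∏ i, D i i := by
  let : LinearOrder ι := LinearOrder.lift' b hb
  have hD' : D.BlockTriangular id := fun i j hij => hD hij
  convert! det_of_isUpperTriangular hD'

/-- Leading positions in distinct rows and distinct columns give a matrix of large rank. -/
theorem exists_le_rank_of_isLeading {F : Type*} [Field F] {k m n : ℕ}
    {C : Submodule F (Matrix (Fin k) (Fin m) F)} {g : Fin n → Fin k} {h : Fin n → Fin m}
    (hg : StrictMono g) (hh : Function.Injective h) (hl : ∀ s, IsLeading C (g s, h s)) :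
    ∃ M ∈ C, n ≤ M.rank := by
  choose B hBC hB0 hB using hl
  let D : Matrix (Fin n) (Fin n) F := of fun s t => B s (g s) (h t)
  have hD : D.det ≠ 0 := by
    rw [det_eq_prod_diag_of_blockTriangular hh]
    · exact prod_ne_zero_iff.2 fun s _ => hB0 s
    · intro s t hst
      exact hB s (g s, h t) (Prod.Lex.toLex_lt_toLex.2 (Or.inr ⟨rfl, hst⟩))
  -- Rows of `D` are replaced one by one with rows of a single codeword. Adding `c • B a` leaves the
  -- earlier rows alone and makes the determinant affine in `c` with nonzero slope, so `c = 0` or `c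
  -- = 1` works over any field.
  have key : ∀ j ≤ n, ∃ N ∈ C,
      det (of fun s t : Fin n => if s.1 < j then N (g s) (h t) else D s t) ≠ 0 := by
    intro j
    induction j with
    | zero => exact fun _ => ⟨0, C.zero_mem, by simpa [D] using hD⟩
    | succ j ih =>
      intro hj
      obtain ⟨N, hN, hdet⟩ := ih (by omega)
      set P : Matrix (Fin n) (Fin n) F :=
        of fun s t : Fin n => if s.1 < j then N (g s) (h t) else D s t with hP
      let a : Fin n := ⟨j, hj⟩
      have hPa : P a = D a := by ext t; simp [hP, a]
      have step : ∀ c : F, (of fun s t : Fin n =>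
          if s.1 < j + 1 then (N + c • B a) (g s) (h t) else D s t).det =
          (P.updateRow a fun t => N (g a) (h t)).det + c * P.det := by
        intro c
        have : (of fun s t : Fin n =>
          if s.1 < j + 1 then (N + c • B a) (g s) (h t) else D s t) =
            P.updateRow a ((fun t => N (g a) (h t)) + c • P a) := by
          ext s t
          by_cases hs : s = a
          · subst hs
            rw [updateRow_self, hPa]
            simp [a, D]
          · rw [updateRow_ne hs]
            have hne : s.1 ≠ j := fun e => hs (Fin.ext e)
            by_cases hlt : s.1 < j
            · have : B a (g s) (h t) = 0 :=
                hB a (g s, h t) (Prod.Lex.toLex_lt_toLex.2 (Or.inl (hg hlt)))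
              rw [hP, of_apply, of_apply, if_pos hlt, if_pos (Nat.lt_succ_of_lt hlt)]
              simp [this]
            · have : ¬ s.1 < j + 1 := by omega
              rw [hP, of_apply, of_apply, if_neg hlt, if_neg this]
        rw [this, det_updateRow_add, det_updateRow_smul, updateRow_eq_self]
      by_cases h0 : (P.updateRow a fun t => N (g a) (h t)).det = 0
      · refine ⟨N + (1 : F) • B a, C.add_mem hN (C.smul_mem _ (hBC a)), ?_⟩
        rw [step, h0]
        simpa using hdet
      · refine ⟨N + (0 : F) • B a, C.add_mem hN (C.smul_mem _ (hBC a)), ?_⟩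
        rw [step]
        simpa using h0
  obtain ⟨N, hN, hdet⟩ := key n le_rfl
  refine ⟨N, hN, ?_⟩
  have hsub : (of fun s t : Fin n => if s.1 < n then N (g s) (h t) else D s t) =
      N.submatrix g h := by
    ext s t
    simp
  rw [hsub] at hdet
  have := rank_of_isUnit _ ((isUnit_iff_isUnit_det _).2 hdet.isUnit)
  rw [Fintype.card_fin] at this
  exact this.symm.le.trans (rank_submatrix_le N g h)

/-! ### Covering positions by lines -/

/-- The deficiency version of Hall's theorem: a set of positions without large partial
matchings is covered by few lines. -/
theorem exists_cover_of_matching_le {k m R : ℕ} (S : Fin k × Fin m → Prop)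
    (hS : ∀ (n : ℕ) (g : Fin n → Fin k) (h : Fin n → Fin m), StrictMono g →
      Function.Injective h → (∀ s, S (g s, h s)) → n ≤ R) :
    ∃ (J : Finset (Fin k)) (N : Finset (Fin m)), k + #N ≤ R + #J ∧
      ∀ p, S p → p.1 ∈ J → p.2 ∈ N := by
  classical
  by_contra! hcon
  let nb : Fin k → Finset (Fin m) := fun i => univ.filter fun j => S (i, j)
  have hdef : ∀ J : Finset (Fin k), R + #J < k + #(J.biUnion nb) := by
    intro J
    by_contra! hJ
    obtain ⟨p, hp, hpJ, hpN⟩ := hcon J _ hJ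
    exact hpN (mem_biUnion.2 ⟨p.1, hpJ, by simpa [nb] using hp⟩)
  have hRk : R < k := by simpa using hdef ∅
  -- With `k - R - 1` dummy columns open to every row, Hall's condition is exactly `hdef`; at least
  -- `R + 1` rows then get genuine columns.
  let t : Fin k → Finset (Fin m ⊕ Fin (k - R - 1)) := fun i => (nb i).disjSum univ
  obtain ⟨f, hf, hft⟩ := (Finset.all_card_le_biUnion_card_iff_exists_injective t).1 (by
    intro J
    rcases J.eq_empty_or_nonempty with rfl | ⟨i, hi⟩
    · simp
    · have hsub : (J.biUnion nb).disjSum univ ⊆ J.biUnion t := by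
        intro x hx
        rcases mem_disjSum.1 hx with ⟨y, hy, rfl⟩ | ⟨y, hy, rfl⟩
        · obtain ⟨i', hi', hy'⟩ := mem_biUnion.1 hy
          exact mem_biUnion.2 ⟨i', hi', inl_mem_disjSum.2 hy'⟩
        · exact mem_biUnion.2 ⟨i, hi, inr_mem_disjSum.2 (mem_univ _)⟩
      have := card_le_card hsub
      rw [card_disjSum, card_univ, Fintype.card_fin] at this
      have := hdef J
      omega)
  let T : Finset (Fin k) := univ.filter fun i => (f i).isLeft
  have hTc : #Tᶜ ≤ k - R - 1 := by
    have hright : ∀ i ∈ Tᶜ, ∃ y, f i = Sum.inr y := by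
      intro i hi
      rcases hfi : f i with y | y
      · simp [T, hfi] at hi
      · exact ⟨y, rfl⟩
    have : Tᶜ.image f ⊆ (univ : Finset (Fin (k - R - 1))).image Sum.inr := by
      intro x hx
      obtain ⟨i, hi, rfl⟩ := mem_image.1 hx
      obtain ⟨y, hy⟩ := hright i hi
      exact mem_image.2 ⟨y, mem_univ _, hy.symm⟩
    have h2 := (card_le_card this).trans card_image_le
    rw [card_image_of_injective _ hf, card_univ, Fintype.card_fin] at h2
    exact h2
  have hT : R < #T := by
    have := card_add_card_compl T
    rw [Fintype.card_fin] at this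
    omega
  have hleft : ∀ s : Fin #T, ∃ y, f (T.orderEmbOfFin rfl s) = Sum.inl y := by
    intro s
    have := T.orderEmbOfFin_mem rfl s
    exact Sum.isLeft_iff.1 (by simpa [T] using (mem_filter.1 this).2)
  choose h hh using hleft
  refine absurd (hS #T (T.orderEmbOfFin rfl) h (T.orderEmbOfFin rfl).strictMono ?_ ?_)
    (not_le.2 hT)
  · intro s s' e
    have := hh s
    rw [e, ← hh s'] at this
    exact (T.orderEmbOfFin rfl).injective (hf this)
  · intro s
    have := hft (T.orderEmbOfFin rfl s)
    rw [hh s] at this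
    simpa [t, nb] using this


/-! ### Linear maps with values in the span of their arguments -/

theorem exists_linearIndependent_notMem_span {F E ι : Type*} [Field F] [AddCommGroup E]
    [Module F E] [FiniteDimensional F E] [Fintype ι] (hc : Fintype.card ι < Module.finrank F E)
    (i : ι) {y z : E} (hyz : LinearIndependent F ![y, z]) :
    ∃ r : ι → E, LinearIndependent F r ∧ r i = y ∧ z ∉ Submodule.span F (Set.range r) := by
  classical
  have hs := hyz.linearIndepOn_id
  let b := Module.Basis.extend hs
  have hmem := Module.Basis.subset_extend hs
  let y' : hs.extend (Set.subset_univ _) := ⟨y, hmem ⟨0, rfl⟩⟩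
  let z' : hs.extend (Set.subset_univ _) := ⟨z, hmem ⟨1, rfl⟩⟩
  have hne : y' ≠ z' := by
    intro e
    exact absurd (hyz.injective (a₁ := 0) (a₂ := 1) (congrArg Subtype.val e)) (by decide)
  have : Fintype (hs.extend (Set.subset_univ _)) := FiniteDimensional.fintypeBasisIndex b
  have hcard : Fintype.card ι ≤ Fintype.card {x // x ≠ z'} := by
    rw [Module.finrank_eq_card_basis b] at hc
    have h1 := Fintype.card_subtype_compl (fun x => x = z')
    rw [Fintype.card_subtype_eq] at h1
    have h2 := Fintype.card_congr (Equiv.refl {x // x ≠ z'})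
    exact (Nat.le_sub_one_of_lt hc).trans (h1.symm.trans h2).le
  obtain ⟨e⟩ := Function.Embedding.nonempty_of_card_le hcard
  let e' : ι → {x // x ≠ z'} := fun j => Equiv.swap (e i) ⟨y', hne⟩ (e j)
  have he' : Function.Injective e' := (Equiv.injective _).comp e.injective
  refine ⟨fun j => b (e' j).1,
    b.linearIndependent.comp _ (Subtype.val_injective.comp he'), ?_, ?_⟩
  · simp [e', b, y']
  · have hz : z = b z' := by simp [b, z']
    intro h
    have hsub : Set.range (fun j => b (e' j).1) ⊆ b '' {x | x ≠ z'} := by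
      rintro _ ⟨j, rfl⟩
      exact ⟨_, (e' j).2, rfl⟩
    refine b.linearIndependent.notMem_span_image (s := {x | x ≠ z'}) (x := z') (by simp) ?_
    rw [← hz]
    exact Submodule.span_mono hsub h

/-- A linear function of few vectors that takes a value in the span of the vectors whenever
these are linearly independent is a linear combination with constant coefficients. -/
theorem exists_eq_sum_smul_of_mem_span {F E ι : Type*} [Field F] [AddCommGroup E]
    [Module F E] [FiniteDimensional F E] [Fintype ι] (hc : Fintype.card ι < Module.finrank F E)
    (g : (ι → E) →ₗ[F] E)
    (hg : ∀ r, LinearIndependent F r → g r ∈ Submodule.span F (Set.range r)) :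
    ∃ c : ι → F, ∀ r, g r = ∑ i, c i • r i := by
  classical
  have key : ∀ i, ∃ a : F, g ∘ₗ LinearMap.single F (fun _ => E) i = a • 1 := by
    intro i
    refine LinearMap.exists_eq_smul_id_of_forall_notLinearIndependent fun y hy => ?_
    by_cases hi : ∃ i', i' ≠ i
    · obtain ⟨i', hi'⟩ := hi
      obtain ⟨r, hr, hri, hz⟩ := exists_linearIndependent_notMem_span hc i' hy
      -- Adding `r i' = y` to the `i`-th vector preserves independence and does not enlarge the
      -- span, so the increment `z` of `g` would lie in that span.
      have hr' : LinearIndependent F (r + Pi.single i y) := by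
        have := (linearIndependent_add_smul_iff (v := r) (i := i')
          (c := Pi.single i (1 : F)) (by simp [hi'])).2 hr
        convert! this using 1
        ext j
        by_cases hj : j = i
        · subst hj; simp [hri]
        · simp [hj]
      have hy' : y ∈ Submodule.span F (Set.range r) :=
        hri ▸ Submodule.subset_span ⟨i', rfl⟩
      have hsp : Submodule.span F (Set.range (r + Pi.single i y)) ≤
          Submodule.span F (Set.range r) := by
        rw [Submodule.span_le]
        rintro _ ⟨j, rfl⟩
        refine Submodule.add_mem _ (Submodule.subset_span ⟨j, rfl⟩) ?_
        by_cases hj : j = i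
        · subst hj; simpa using hy'
        · simp [hj]
      have h1 := Submodule.sub_mem _ (hsp (hg _ hr')) (hg _ hr)
      rw [map_add, add_sub_cancel_left] at h1
      exact hz h1
    · push Not at hi
      obtain ⟨r, hr, hri, hz⟩ := exists_linearIndependent_notMem_span hc i hy
      have : r = Pi.single i y := by
        ext j
        rw [hi j, hri, Pi.single_eq_same]
      exact hz (this ▸ hg r hr)
  choose c hc using key
  refine ⟨c, fun r => ?_⟩
  conv_lhs => rw [← univ_sum_single r, map_sum]
  refine sum_congr rfl fun i _ => ?_
  simpa using LinearMap.congr_fun (hc i) (r i)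

/-! ### Subcodes of smaller rank -/

/-- If the matrices in `C` have arbitrary rows on an index set `I` and are determined by these
rows, and the ranks in `C` are at most the size of `I`, then `C` contains optimal anticodes of
all smaller ranks. -/
theorem exists_subcode_of_rows {F : Type*} [Field F] {k m : ℕ} (hkm : k ≤ m)
    {C : Submodule F (Matrix (Fin k) (Fin m) F)} (I : Finset (Fin k))
    (hC : Module.finrank F C = m * #I) (hrk : ∀ M ∈ C, M.rank ≤ #I)
    (hinj : ∀ M ∈ C, (∀ i ∈ I, M i = 0) → M = 0) {s : ℕ} (hs : s ≤ #I) :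
    ∃ A ≤ C, Module.finrank F A = m * s ∧ (∀ M ∈ A, M.rank ≤ s) ∧ ∃ M ∈ A, s ≤ M.rank := by
  classical
  let φ : C →ₗ[F] (I → Fin m → F) :=
    { toFun := fun M i => M.1 i, map_add' := fun _ _ => rfl, map_smul' := fun _ _ => rfl }
  have hφ : Function.Injective φ := by
    rw [← LinearMap.ker_eq_bot, LinearMap.ker_eq_bot']
    intro M hM
    exact Subtype.ext (hinj M.1 M.2 fun i hi => congrFun hM ⟨i, hi⟩)
  let e := LinearMap.linearEquivOfInjective φ hφ (by
    rw [hC, Module.finrank_pi_fintype]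
    simp [mul_comm])
  let ψ : (I → Fin m → F) →ₗ[F] Matrix (Fin k) (Fin m) F := C.subtype ∘ₗ e.symm.toLinearMap
  have hψC : ∀ r, ψ r ∈ C := fun r => (e.symm r).2
  have hψI : ∀ r (i : I), ψ r i = r i := fun r i => congrFun (e.apply_symm_apply r) i
  have hψ : ∀ j, ∃ c : I → F, ∀ r, ψ r j = ∑ i, c i • r i := by
    intro j
    by_cases hj : j ∈ I
    · refine ⟨Pi.single ⟨j, hj⟩ 1, fun r => ?_⟩
      rw [sum_eq_single ⟨j, hj⟩]
      · simpa using hψI r ⟨j, hj⟩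
      · intro i _ hi
        simp [hi]
      · simp
    · have hIk : #I < k := by
        have := card_lt_univ_of_notMem hj
        rwa [Fintype.card_fin] at this
      let row : Matrix (Fin k) (Fin m) F →ₗ[F] (Fin m → F) :=
        { toFun := fun M => M j, map_add' := fun _ _ => rfl, map_smul' := fun _ _ => rfl }
      refine exists_eq_sum_smul_of_mem_span (by simpa using hIk.trans_le hkm) (row ∘ₗ ψ) ?_
      intro r hr
      have hle : Submodule.span F (Set.range r) ≤ Submodule.span F (Set.range (ψ r).row) := by
        refine Submodule.span_mono ?_
        rintro _ ⟨i, rfl⟩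
        exact ⟨i.1, hψI r i⟩
      -- The `#I` independent rows already exhaust the rank bound, so they span the row space.
      have heq := Submodule.eq_of_le_of_finrank_le hle (by
        rw [← rank_eq_finrank_span_row, finrank_span_eq_card hr, Fintype.card_coe]
        exact hrk _ (hψC r))
      rw [heq]
      exact Submodule.subset_span ⟨j, rfl⟩
  obtain ⟨T, -, hT⟩ := exists_subset_card_eq (s := (univ : Finset I)) (n := s) (by simpa using hs)
  let χ : (T → Fin m → F) →ₗ[F] (I → Fin m → F) :=
    LinearMap.pi fun i => if h : i ∈ T then LinearMap.proj ⟨i, h⟩ else 0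
  have hχT : ∀ x (i : T), χ x i = x i := by
    intro x i
    simp [χ]
  have hχ0 : ∀ x, ∀ i ∉ T, χ x i = 0 := by
    intro x i hi
    simp [χ, hi]
  have hinj' : Function.Injective (ψ ∘ₗ χ) := by
    refine (Subtype.val_injective.comp e.symm.injective).comp fun x y hxy => ?_
    ext1 i
    rw [← hχT x, ← hχT y, hxy]
  refine ⟨(ψ ∘ₗ χ).range, ?_, ?_, ?_, ?_⟩
  · rintro _ ⟨x, rfl⟩
    exact hψC _
  · rw [LinearMap.finrank_range_of_inj hinj', Module.finrank_pi_fintype]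
    simp [hT, mul_comm]
  · rintro _ ⟨x, rfl⟩
    have hle : Submodule.span F (Set.range (ψ (χ x)).row) ≤
        Submodule.span F (Set.range x) := by
      rw [Submodule.span_le]
      rintro _ ⟨j, rfl⟩
      obtain ⟨c, hc⟩ := hψ j
      change ψ (χ x) j ∈ _
      rw [hc]
      refine Submodule.sum_mem _ fun i _ => Submodule.smul_mem _ _ ?_
      by_cases hi : i ∈ T
      · exact Submodule.subset_span ⟨⟨i, hi⟩, (hχT x ⟨i, hi⟩).symm⟩
      · rw [hχ0 x i hi]
        exact Submodule.zero_mem _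
    rw [rank_eq_finrank_span_row]
    refine (Submodule.finrank_mono hle).trans ((finrank_range_le_card x).trans ?_)
    simp [hT]
  · have hTm : Fintype.card T ≤ Fintype.card (Fin m) := by
      have := card_le_univ I
      rw [Fintype.card_fin] at this
      rw [Fintype.card_coe, Fintype.card_fin, hT]
      omega
    obtain ⟨u⟩ := Function.Embedding.nonempty_of_card_le hTm
    let x : T → Fin m → F := fun i => Pi.basisFun F (Fin m) (u i)
    have hx : LinearIndependent F x := (Pi.basisFun F (Fin m)).linearIndependent.comp _ u.injective
    refine ⟨ψ (χ x), ⟨x, rfl⟩, ?_⟩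
    have hsub : (ψ (χ x)).submatrix (fun i : T => (i.1.1 : Fin k)) id = of x := by
      ext i j
      exact congrFun ((hψI (χ x) i.1).trans (hχT x i)) j
    have h1 := rank_submatrix_le (ψ (χ x)) (fun i : T => (i.1.1 : Fin k)) id
    rw [hsub, LinearIndependent.rank_matrix (M := of x) hx, Fintype.card_coe, hT] at h1
    exact h1

/-- A code of dimension `m * R` whose ranks are at most `R` contains optimal anticodes of all
smaller ranks. -/
theorem exists_subcode {F : Type*} [Field F] {k m R : ℕ} (hkm : k ≤ m) (hm : 0 < m)
    {C : Submodule F (Matrix (Fin k) (Fin m) F)} (hC : Module.finrank F C = m * R)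
    (hrk : ∀ M ∈ C, M.rank ≤ R) {s : ℕ} (hs : s ≤ R) :
    ∃ A ≤ C, Module.finrank F A = m * s ∧ (∀ M ∈ A, M.rank ≤ s) ∧ ∃ M ∈ A, s ≤ M.rank := by
  classical
  obtain ⟨J, N, hJN, hcov⟩ := exists_cover_of_matching_le (R := R) (IsLeading C)
    fun n g h hg hh hl => by
      obtain ⟨M, hM, hn⟩ := exists_le_rank_of_isLeading hg hh hl
      exact hn.trans (hrk M hM)
  let S : Finset (Fin k × Fin m) := univ.filter (IsLeading C)
  have hCS : m * R ≤ #S := by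
    let φ : C →ₗ[F] (S → F) :=
      { toFun := fun M p => M.1 p.1.1 p.1.2
        map_add' := fun _ _ => rfl
        map_smul' := fun _ _ => rfl }
    have hφ : Function.Injective φ := by
      rw [← LinearMap.ker_eq_bot, LinearMap.ker_eq_bot']
      intro M hM
      exact Subtype.ext (eq_zero_of_forall_isLeading M.2 fun p hp =>
        congrFun hM ⟨p, by simpa [S] using hp⟩)
    have := LinearMap.finrank_le_finrank_of_injective hφ
    rwa [hC, Module.finrank_fintype_fun_eq_card, Fintype.card_coe] at this
  have hSJ : #S ≤ #Jᶜ * m + #J * #N := by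
    have hsub : S ⊆ Jᶜ ×ˢ univ ∪ J ×ˢ N := by
      intro p hp
      have := hcov p (by simpa [S] using hp)
      by_cases hpJ : p.1 ∈ J <;> simp [hpJ, this]
    refine (card_le_card hsub).trans ((card_union_le _ _).trans ?_)
    simp [card_product]
  have hJ := card_add_card_compl J
  rw [Fintype.card_fin] at hJ
  rcases Nat.eq_zero_or_pos #N with hN | hN
  · rw [card_eq_zero] at hN
    subst hN
    have hR : #Jᶜ = R := by
      rw [card_empty] at hSJ hJN
      have : m * R ≤ m * #Jᶜ := by linarith
      have := Nat.le_of_mul_le_mul_left this hm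
      omega
    rw [← hR] at hC hrk hs
    refine exists_subcode_of_rows hkm Jᶜ hC hrk (fun M hM h0 => ?_) hs
    refine eq_zero_of_forall_isLeading hM fun p hp => congrFun (h0 p.1 ?_) p.2
    rw [mem_compl]
    exact fun hpJ => absurd (hcov p hp hpJ) (notMem_empty _)
  -- If a column is used, the count gives `m * #N ≤ #J * #N`; hence `m ≤ #J ≤ k`, the matrices are
  -- square and no row is used.
  · have hmJ : m ≤ #J := by
      have h1 : m * (#Jᶜ + #N) ≤ m * R := Nat.mul_le_mul_left _ (by omega)
      have h2 : m * #N ≤ #J * #N := by linarith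
      exact Nat.le_of_mul_le_mul_right h2 hN
    obtain rfl : k = m := by omega
    have hNR : #N = R := by
      have h0 : #Jᶜ = 0 := by omega
      have hJk : #J = k := by omega
      rw [h0, hJk] at hSJ
      have : k * R ≤ k * #N := by linarith
      have := Nat.le_of_mul_le_mul_left this hm
      omega
    have hJu : J = univ := by
      rw [← card_eq_iff_eq_univ, Fintype.card_fin]
      omega
    rw [← hNR] at hC hrk hs
    let τ := transposeLinearEquiv (Fin k) (Fin k) F F
    obtain ⟨A, hA, hdim, hle, M, hM, hge⟩ := exists_subcode_of_rows le_rfl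
      (C := C.map τ.toLinearMap) N (by rw [LinearEquiv.finrank_map_eq, hC])
      (by
        rintro _ ⟨M, hM, rfl⟩
        exact (rank_transpose M).trans_le (hrk M hM))
      (by
        rintro _ ⟨M, hM, rfl⟩ h0
        have : M = 0 := eq_zero_of_forall_isLeading hM fun p hp =>
          congrFun (h0 p.2 (hcov p hp (hJu ▸ mem_univ _))) p.1
        rw [this, map_zero]) hs
    refine ⟨A.map τ.toLinearMap, ?_, by rw [LinearEquiv.finrank_map_eq, hdim], ?_,
      τ M, ⟨M, hM, rfl⟩, hge.trans (rank_transpose M).ge⟩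
    · rintro _ ⟨B, hB, rfl⟩
      obtain ⟨D, hD, rfl⟩ := hA hB
      exact hD
    · rintro _ ⟨B, hB, rfl⟩
      exact (rank_transpose B).trans_le (hle B hB)

/-! ### Generalized weights -/

theorem rank_le_maxrk {F : Type*} [Field F] {k m : ℕ}
    {C : Submodule F (Matrix (Fin k) (Fin m) F)} {M : Matrix (Fin k) (Fin m) F} (hM : M ∈ C) :
    M.rank ≤ maxrk C := by
  refine le_csSup ⟨k, ?_⟩ ⟨M, hM, rfl⟩
  rintro _ ⟨N, -, rfl⟩
  exact (rank_le_card_height N).trans_eq (Fintype.card_fin k)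

theorem maxrk_eq {F : Type*} [Field F] {k m s : ℕ}
    {C : Submodule F (Matrix (Fin k) (Fin m) F)} (hle : ∀ M ∈ C, M.rank ≤ s)
    (hge : ∃ M ∈ C, s ≤ M.rank) : maxrk C = s := by
  obtain ⟨M, hM, hs⟩ := hge
  refine le_antisymm (csSup_le ⟨_, M, hM, rfl⟩ ?_) (hs.trans (rank_le_maxrk hM))
  rintro _ ⟨N, hN, rfl⟩
  exact hle N hN

/-- The generalized weights of an optimal anticode. -/
theorem IsOptimalAnticode.genWeight_eq {F : Type*} [Field F] {k m R r : ℕ} (hkm : k ≤ m)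
    (hm : 0 < m) {C : Submodule F (Matrix (Fin k) (Fin m) F)} (hopt : IsOptimalAnticode C)
    (hR : maxrk C = R) (hr : r ≤ m * R) :
    genWeight r C = ((⌈(r : ℚ) / (m : ℚ)⌉ : ℤ) : ℚ) := by
  have hmQ : (0 : ℚ) < m := Nat.cast_pos.2 hm
  set s := ⌈(r : ℚ) / (m : ℚ)⌉₊ with hs
  have hs_le : ∀ t : ℕ, r ≤ m * t ↔ s ≤ t := by
    intro t
    rw [hs, Nat.ceil_le, div_le_iff₀ hmQ, mul_comm]
    norm_cast
  have hmin : sInf {d : ℕ | ∃ A : Submodule F (Matrix (Fin k) (Fin m) F),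
      IsOptimalAnticode A ∧ r ≤ Module.finrank F (A ⊓ C : Submodule F _) ∧
        Module.finrank F A = d} = m * s := by
    refine IsLeast.csInf_eq ⟨?_, ?_⟩
    · have hC : Module.finrank F C = m * R := by rw [← hR]; exact hopt
      obtain ⟨A, hA, hdim, hle, hge⟩ := exists_subcode hkm hm hC
        (fun M hM => hR ▸ rank_le_maxrk hM) ((hs_le R).1 hr)
      refine ⟨A, ?_, ?_, hdim⟩
      · rw [IsOptimalAnticode, hdim, maxrk_eq hle hge]
      · rw [inf_eq_left.2 hA, hdim]
        exact (hs_le s).2 le_rfl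
    · rintro _ ⟨A, hA, hrA, rfl⟩
      have hAd : Module.finrank F A = m * maxrk A := hA
      have := hrA.trans (Submodule.finrank_mono inf_le_left)
      rw [hAd] at this ⊢
      exact Nat.mul_le_mul_left m ((hs_le _).1 this)
  rw [genWeight, hmin, ← natCast_ceil_eq_intCast_ceil (by positivity), ← hs]
  push_cast
  field_simp

/-- A code of dimension `m * R` whose last generalized weight is `R` is an optimal anticode. -/
theorem isOptimalAnticode_of_genWeight_eq {F : Type*} [Field F] {k m R : ℕ} (hm : 0 < m)
    (hR : 1 ≤ R) {C : Submodule F (Matrix (Fin k) (Fin m) F)}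
    (hC : Module.finrank F C = m * R) (h : genWeight (m * R) C = (R : ℚ)) :
    IsOptimalAnticode C := by
  rw [genWeight] at h
  set X := {d : ℕ | ∃ A : Submodule F (Matrix (Fin k) (Fin m) F),
      IsOptimalAnticode A ∧ m * R ≤ Module.finrank F (A ⊓ C : Submodule F _) ∧
        Module.finrank F A = d} with hX
  have hmQ : (m : ℚ) ≠ 0 := Nat.cast_ne_zero.2 hm.ne'
  have hinf : sInf X = m * R := by
    have : ((sInf X : ℕ) : ℚ) = ((m * R : ℕ) : ℚ) := by
      push_cast
      rw [← h]
      field_simp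
    exact_mod_cast this
  -- `sInf ∅ = 0`, so a positive infimum is attained.
  have hne : X.Nonempty := Nat.nonempty_of_pos_sInf (hinf ▸ Nat.mul_pos hm hR)
  obtain ⟨A, hA, hAC, hdim⟩ := Nat.sInf_mem hne
  have h1 : A ⊓ C = A := Submodule.eq_of_le_of_finrank_le inf_le_left (by
    rw [hdim, hinf]; exact hAC)
  have h2 : A ⊓ C = C := Submodule.eq_of_le_of_finrank_le inf_le_right (by
    rw [hC]; exact hAC)
  rwa [← h2, h1]

end DelsarteCode

theorem corollary6p5 {F : Type*} [Field F] [Finite F] {k m R : ℕ}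
    (hR : 1 ≤ R) (hRk : R ≤ k) (hkm : k ≤ m)
    (C : Submodule F (Matrix (Fin k) (Fin m) F))
    (hC : Module.finrank F C = m * R) :
    [DelsarteCode.IsOptimalAnticode C,
      DelsarteCode.genWeight (m * R) C = (R : ℚ),
      ∀ r ∈ Finset.Icc 1 (m * R),
        DelsarteCode.genWeight r C = ((⌈(r : ℚ) / (m : ℚ)⌉ : ℤ) : ℚ)].TFAE ∧
    (∀ {K : Type*} [Field K] [Finite K] (D : Submodule K (Matrix (Fin k) (Fin m) K)),
      DelsarteCode.IsOptimalAnticode C → DelsarteCode.IsOptimalAnticode D →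
      DelsarteCode.maxrk D = DelsarteCode.maxrk C →
      ∀ r ∈ Finset.Icc 1 (m * R),
        DelsarteCode.genWeight r D = DelsarteCode.genWeight r C) := by
  have hm : 0 < m := by omega
  have hmaxrk : DelsarteCode.IsOptimalAnticode C → DelsarteCode.maxrk C = R := fun h =>
    (Nat.eq_of_mul_eq_mul_left hm (hC.symm.trans h)).symm
  constructor
  · tfae_have 1 → 3 := fun h r hr =>
      h.genWeight_eq hkm hm (hmaxrk h) (Finset.mem_Icc.1 hr).2
    tfae_have 3 → 2 := by
      intro h
      rw [h (m * R) (Finset.mem_Icc.2 ⟨Nat.mul_pos hm hR, le_rfl⟩)]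
      have hmQ : (m : ℚ) ≠ 0 := Nat.cast_ne_zero.2 hm.ne'
      rw [Nat.cast_mul, mul_div_cancel_left₀ _ hmQ]
      simp
    tfae_have 2 → 1 := DelsarteCode.isOptimalAnticode_of_genWeight_eq hm hR hC
    tfae_finish
  · intro K _ _ D hCo hD hDC r hr
    have hr' := (Finset.mem_Icc.1 hr).2
    rw [hCo.genWeight_eq hkm hm (hmaxrk hCo) hr',
      hD.genWeight_eq hkm hm (hDC.trans (hmaxrk hCo)) hr']
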